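/- Let $n\ge 0$, let $\mathcal H_n=(\mathbb C^2)^{\otimes n}$ be the space of $n$ qubits, on which $U\in SU(2)$ acts as $U^{\otimes n}$, and let $\Upsilon_n(\rho)=\int_{SU(2)}U^{\otimes n}\rho\,(U^{\otimes n})^\dagger\,dU$ ($dU$ the normalized Haar measure), acting on density matrices $\rho$ on $\mathcal H_n$. Let $\mathcal H^0_{2n}$ be the $SU(2)$-invariant subspace of $\mathcal H_{2n}=\mathcal H_n^{A}\otimes\mathcal H_n^{B}$, i.e. the set of vectors fixed by $U^{\otimes n}\otimes U^{\otimes n}$ for all $U\in SU(2)$, and let $\mathrm{Den}(\mathcal H^0_{2n})$ be the set of density matrices on $\mathcal H_{2n}$ supported on $\mathcal H^0_{2n}$. Then $$\mathrm{Tr}_B\big(\mathrm{Den}(\mathcal H^0_{2n})\big)=\mathrm{Im}(\Upsilon_n),$$ where $\mathrm{Im}(\Upsilon_n)$ is the image under $\Upsilon_n$ of the set of density matrices on $\mathcal H_n$. In particular, for every $\rho\in\mathrm{Im}(\Upsilon_n)$ there is a pure state $\widetilde\rho\in\mathrm{Den}(\mathcal H^0_{2n})$ with $\rho=\mathrm{Tr}_B(\widetilde\rho)$;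 and for each such pure $\widetilde\rho$ the entropy of $\rho$ is the entanglement of $\widetilde\rho$: $S(\rho)=E(\widetilde\rho\,|A:B)$. Here $S(\rho)=-\mathrm{Tr}\,\rho\log\rho$, and $E(\widetilde\rho\,|A:B)$ is the entanglement of formation, the minimum of $\sum_i w_i\,S(\mathrm{Tr}_B|\Psi_i\rangle\langle\Psi_i|)$ over all decompositions $\widetilde\rho=\sum_i w_i|\Psi_i\rangle\langle\Psi_i|$ into finite mixtures of pure states (with $w_i>0$, $\sum_i w_i=1$). -/

import Mathlib

open MeasureTheory
open scoped Matrix Kronecker ComplexOrder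

noncomputable section

namespace Twirl

/-- The group `SU(2)` of `2 × 2` complex unitary matrices of determinant one, with the topology
induced from the space of matrices. -/
abbrev SU2 : Type := Matrix.specialUnitaryGroup (Fin 2) ℂ

instance : IsTopologicalGroup SU2 where
  continuous_mul := by
    refine Continuous.subtype_mk ?_ _
    exact (continuous_subtype_val.comp continuous_fst).mul
      (continuous_subtype_val.comp continuous_snd)
  continuous_inv := by
    refine Continuous.subtype_mk ?_ _
    exact continuous_star.comp continuous_subtype_val

instance : CompactSpace SU2 := by
  refine isCompact_iff_compactSpace.mp ?_
  have hK : IsCompact (Set.univ.pi fun _ : Fin 2 => Set.univ.pi fun _ : Fin 2 =>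
      Metric.closedBall (0 : ℂ) 1) :=
    isCompact_univ_pi fun _ => isCompact_univ_pi fun _ => isCompact_closedBall _ _
  have hcl : IsClosed (Matrix.specialUnitaryGroup (Fin 2) ℂ : Set (Matrix (Fin 2) (Fin 2) ℂ)) := by
    have h : (Matrix.specialUnitaryGroup (Fin 2) ℂ : Set (Matrix (Fin 2) (Fin 2) ℂ)) =
        {A | A * star A = 1} ∩ {A | A.det = 1} := by
      ext A
      simp [Matrix.mem_specialUnitaryGroup_iff, Matrix.mem_unitaryGroup_iff]
    rw [h]
    exact (isClosed_eq (continuous_id.mul continuous_star) continuous_const).inter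
      (isClosed_eq continuous_id.matrix_det continuous_const)
  refine IsCompact.of_isClosed_subset hK hcl ?_
  intro A hA i _ j _
  rw [mem_closedBall_zero_iff]
  exact entry_norm_bound_of_unitary hA.1 i j

instance : MeasurableSpace SU2 := borel SU2

instance : BorelSpace SU2 := ⟨rfl⟩

/-- The Haar measure of the compact group `SU(2)`, normalized to total mass one. -/
def haarSU2 : Measure SU2 := Measure.haarMeasure ⊤

/-- Labels of the computational basis of `n` qubits. The space `H_n = (ℂ²)^{⊗ n}` is the space of
functions `Basis n → ℂ` with the standard Hermitian product, the basis vector labelled by `x`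
being `e_{x 0} ⊗ ⋯ ⊗ e_{x (n-1)}`. -/
abbrev Basis (n : ℕ) : Type := Fin n → Fin 2

/-- The matrix of `U ⊗ ⋯ ⊗ U` (`n` factors) on `H_n`. -/
def tensorPower (n : ℕ) (U : SU2) : Matrix (Basis n) (Basis n) ℂ :=
  Matrix.of fun x y => ∏ i, (U : Matrix (Fin 2) (Fin 2) ℂ) (x i) (y i)

/-- The twirling map `Υ(ρ) = ∫ U ρ U† dU` on operators on `H_n`, where `U` acts as `U^{⊗ n}`;
the integral of a matrix-valued function is taken entrywise. -/
def twirl (n : ℕ) (ρ : Matrix (Basis n) (Basis n) ℂ) : Matrix (Basis n) (Basis n) ℂ :=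
  Matrix.of fun x y => ∫ U : SU2, (tensorPower n U * ρ * (tensorPower n U)ᴴ) x y ∂haarSU2

/-- The `SU(2)`-invariant subspace of `H_{2n} = H_n^A ⊗ H_n^B`: the vectors fixed by
`U^{⊗ 2n} = U^{⊗ n} ⊗ U^{⊗ n}` for every `U` in `SU(2)`. -/
def invariantSubspace (n : ℕ) : Submodule ℂ (Basis n × Basis n → ℂ) where
  carrier := {ψ | ∀ U : SU2, (tensorPower n U ⊗ₖ tensorPower n U) *ᵥ ψ = ψ}
  add_mem' := by
    intro ψ φ hψ hφ U
    rw [Matrix.mulVec_add, hψ U, hφ U]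
  zero_mem' := fun U => Matrix.mulVec_zero _
  smul_mem' := by
    intro c ψ hψ U
    rw [Matrix.mulVec_smul, hψ U]

section General

variable {α β : Type*} [Fintype α] [DecidableEq α] [Fintype β] [DecidableEq β]

/-- Density matrices: positive semidefinite of trace one. -/
def IsDensity (ρ : Matrix α α ℂ) : Prop :=
  ρ.PosSemidef ∧ ρ.trace = 1

/-- Density matrices on a subspace `W`: density matrices whose range (equivalently, whose support)
lies in `W`. -/
def IsDensityOn (W : Submodule ℂ (α → ℂ)) (ρ : Matrix α α ℂ) : Prop :=
  IsDensity ρ ∧ ∀ v, ρ *ᵥ v ∈ W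

/-- Unit vectors for the standard Hermitian product. -/
def IsUnitVector (ψ : α → ℂ) : Prop :=
  star ψ ⬝ᵥ ψ = 1

/-- The rank-one operator `|ψ⟩⟨ψ|`. -/
def ketbra (ψ : α → ℂ) : Matrix α α ℂ :=
  Matrix.vecMulVec ψ (star ψ)

/-- Pure states: `|ψ⟩⟨ψ|` for a unit vector `ψ`. -/
def IsPure (ρ : Matrix α α ℂ) : Prop :=
  ∃ ψ : α → ℂ, IsUnitVector ψ ∧ ρ = ketbra ψ

/-- The partial trace over the second tensor factor. -/
def partialTraceB (ρ : Matrix (α × β) (α × β) ℂ) : Matrix α α ℂ :=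
  Matrix.of fun a a' => ∑ b, ρ (a, b) (a', b)

open Classical in
/-- The von Neumann entropy `S(ρ) = -tr (ρ log ρ)`, that is `-∑ λ log λ` over the eigenvalues `λ`
of the Hermitian matrix `ρ`, with multiplicity and with `0 log 0 = 0`. -/
def entropy (ρ : Matrix α α ℂ) : ℝ :=
  if h : ρ.IsHermitian then ∑ i, Real.negMulLog (h.eigenvalues i) else 0

/-- The averages `∑ i, w i * S(tr_B |Ψ i⟩⟨Ψ i|)` over all decompositions
`ρ = ∑ i, w i |Ψ i⟩⟨Ψ i|` of `ρ` into finite mixtures of pure states. -/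
def averageEntanglements (ρ : Matrix (α × β) (α × β) ℂ) : Set ℝ :=
  {e | ∃ (m : ℕ) (w : Fin m → ℝ) (Ψ : Fin m → α × β → ℂ),
    (∀ i, 0 < w i) ∧ ∑ i, w i = 1 ∧ (∀ i, IsUnitVector (Ψ i)) ∧
    ρ = ∑ i, (w i : ℂ) • ketbra (Ψ i) ∧
    e = ∑ i, w i * entropy (partialTraceB (ketbra (Ψ i)))}

/-- The entanglement `E(ρ | A : B)` (entanglement of formation): the infimum (attained for density matrices) of the average
entanglement over all decompositions of `ρ` into pure states. -/
def entanglement (ρ : Matrix (α × β) (α × β) ℂ) : ℝ :=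
  sInf (averageEntanglements ρ)

end General

end Twirl

end

/-! Both sides of the equality are the density matrices commuting with every `T = U^{⊗n}`. For the
twirl this is `mem_image_twirl_iff`: Haar averaging produces commuting matrices and fixes those that
already commute. A partial trace commutes because an invariant `σ` lets `T` on A be traded for `Tᴴ`
on B, and `Tr_B` is cyclic in operators on B (`IsDensityOn.commute_partialTraceB`). Conversely, read
a vector of `H_A ⊗ H_B` as a matrix `M`: `T ⊗ T` sends it to `T M Tᵀ`, and its reduced state is `M
Mᴴ`. With `E = (iσ_y)^{⊗n}` one has `T E Tᵀ = E`, so `M = √ρ E` is an invariant purification of a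
commuting `ρ` (`exists_invariant_purification`). The entropy claim needs no symmetry: a pure state
is extreme, so its mixtures are trivial. -/

namespace Twirl

open scoped MatrixOrder

/-! ### Tensor powers and the self-duality of the representation. -/

section TensorPower

/-- The `n`-fold Kronecker power of a `2 × 2` matrix. -/
def kroneckerPower (n : ℕ) (A : Matrix (Fin 2) (Fin 2) ℂ) : Matrix (Basis n) (Basis n) ℂ :=
  Matrix.of fun x y => ∏ i, A (x i) (y i)

theorem kroneckerPower_mul (n : ℕ) (A B : Matrix (Fin 2) (Fin 2) ℂ) :
    kroneckerPower n A * kroneckerPower n B = kroneckerPower n (A * B) := by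
  ext x y
  simp only [kroneckerPower, Matrix.mul_apply, Matrix.of_apply]
  rw [Finset.prod_univ_sum, Fintype.piFinset_univ]
  simp only [Finset.prod_mul_distrib]

theorem kroneckerPower_one (n : ℕ) : kroneckerPower n 1 = 1 := by
  ext x y
  simp only [kroneckerPower, Matrix.of_apply, Matrix.one_apply]
  rw [Finset.prod_ite_zero]
  simp [funext_iff]

theorem kroneckerPower_transpose (n : ℕ) (A : Matrix (Fin 2) (Fin 2) ℂ) :
    (kroneckerPower n A)ᵀ = kroneckerPower n Aᵀ := by
  ext x y
  simp [kroneckerPower]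

theorem kroneckerPower_conjTranspose (n : ℕ) (A : Matrix (Fin 2) (Fin 2) ℂ) :
    (kroneckerPower n A)ᴴ = kroneckerPower n Aᴴ := by
  ext x y
  simp [kroneckerPower]

theorem tensorPower_eq (n : ℕ) (U : SU2) :
    tensorPower n U = kroneckerPower n (U : Matrix (Fin 2) (Fin 2) ℂ) := rfl

theorem tensorPower_mul (n : ℕ) (U V : SU2) :
    tensorPower n (U * V) = tensorPower n U * tensorPower n V := by
  rw [tensorPower_eq, tensorPower_eq, tensorPower_eq, kroneckerPower_mul]
  rfl

theorem conjTranspose_mul_self_SU2 (U : SU2) :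
    (U : Matrix (Fin 2) (Fin 2) ℂ)ᴴ * (U : Matrix (Fin 2) (Fin 2) ℂ) = 1 :=
  Matrix.mem_unitaryGroup_iff'.mp (Matrix.mem_specialUnitaryGroup_iff.mp U.2).1

theorem tensorPower_conjTranspose_mul_self (n : ℕ) (U : SU2) :
    (tensorPower n U)ᴴ * tensorPower n U = 1 := by
  rw [tensorPower_eq, kroneckerPower_conjTranspose, kroneckerPower_mul,
    conjTranspose_mul_self_SU2, kroneckerPower_one]

theorem tensorPower_mul_conjTranspose_self (n : ℕ) (U : SU2) :
    tensorPower n U * (tensorPower n U)ᴴ = 1 :=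
  mul_eq_one_comm.mp (tensorPower_conjTranspose_mul_self n U)

/-- The matrix `iσ_y`, which intertwines the defining representation of `SU(2)` and its dual. -/
def symplecticForm : Matrix (Fin 2) (Fin 2) ℂ := !![0, 1; -1, 0]

/-- For a 2 × 2 matrix `A`, `A ε Aᵀ = det A • ε` with `ε = iσ_y`; only determinant one matters. -/
theorem mul_symplecticForm_mul_transpose (U : SU2) :
    (U : Matrix (Fin 2) (Fin 2) ℂ) * symplecticForm * (U : Matrix (Fin 2) (Fin 2) ℂ)ᵀ =
      symplecticForm := by
  have hdet := (Matrix.mem_specialUnitaryGroup_iff.mp U.2).2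
  rw [Matrix.det_fin_two] at hdet
  ext i j
  fin_cases i <;> fin_cases j <;> simp [symplecticForm, Matrix.mul_apply, Fin.sum_univ_two]
  · ring
  · linear_combination hdet
  · linear_combination -hdet
  · ring

theorem symplecticForm_mul_conjTranspose : symplecticForm * symplecticFormᴴ = 1 := by
  ext i j
  fin_cases i <;> fin_cases j <;> simp [symplecticForm, Matrix.mul_apply, Fin.sum_univ_two]

/-- The conjugation intertwiner `(iσ_y)^{⊗ n}`. -/
def spinFlip (n : ℕ) : Matrix (Basis n) (Basis n) ℂ := kroneckerPower n symplecticForm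

theorem spinFlip_mul_conjTranspose (n : ℕ) : spinFlip n * (spinFlip n)ᴴ = 1 := by
  rw [spinFlip, kroneckerPower_conjTranspose, kroneckerPower_mul,
    symplecticForm_mul_conjTranspose, kroneckerPower_one]

theorem tensorPower_mul_spinFlip_mul_transpose (n : ℕ) (U : SU2) :
    tensorPower n U * spinFlip n * (tensorPower n U)ᵀ = spinFlip n := by
  rw [tensorPower_eq, spinFlip, kroneckerPower_transpose, kroneckerPower_mul, kroneckerPower_mul,
    mul_symplecticForm_mul_transpose]

theorem continuous_tensorPower (n : ℕ) : Continuous (tensorPower n) := by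
  refine continuous_matrix fun x y => ?_
  exact continuous_finsetProd Finset.univ fun i _ =>
    (continuous_subtype_val : Continuous fun U : SU2 => (U : Matrix (Fin 2) (Fin 2) ℂ)).matrix_elem
      (x i) (y i)

end TensorPower

/-! ### Haar averaging and the image of the twirl. -/

section Haar

instance : IsProbabilityMeasure haarSU2 :=
  ⟨Measure.haarMeasure_self (K₀ := (⊤ : TopologicalSpace.PositiveCompacts SU2))⟩

instance : haarSU2.IsMulLeftInvariant :=
  inferInstanceAs (Measure.haarMeasure (⊤ : TopologicalSpace.PositiveCompacts SU2)).IsMulLeftInvariant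

theorem integrable_haarSU2 {f : SU2 → ℂ} (hf : Continuous f) : Integrable f haarSU2 :=
  hf.integrable_of_hasCompactSupport (HasCompactSupport.of_compactSpace f)

theorem continuous_conjugate (n : ℕ) (ρ : Matrix (Basis n) (Basis n) ℂ) :
    Continuous fun U : SU2 => tensorPower n U * ρ * (tensorPower n U)ᴴ :=
  ((continuous_tensorPower n).mul continuous_const).mul (continuous_tensorPower n).matrix_conjTranspose

/-- Lets any linear functional pass under the entrywise integral; used for conjugated entries,
quadratic forms and the trace. -/
theorem sum_mul_twirl (n : ℕ) (ρ c : Matrix (Basis n) (Basis n) ℂ) :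
    ∑ x, ∑ y, c x y * twirl n ρ x y =
      ∫ U : SU2, ∑ x, ∑ y, c x y * (tensorPower n U * ρ * (tensorPower n U)ᴴ) x y ∂haarSU2 := by
  have hc : ∀ x y, Continuous fun U : SU2 =>
      c x y * (tensorPower n U * ρ * (tensorPower n U)ᴴ) x y := fun x y =>
    continuous_const.mul ((continuous_conjugate n ρ).matrix_elem x y)
  rw [integral_finsetSum _ fun x _ =>
    integrable_haarSU2 (continuous_finsetSum _ fun y _ => hc x y)]
  refine Finset.sum_congr rfl fun x _ => ?_
  rw [integral_finsetSum _ fun y _ => integrable_haarSU2 (hc x y)]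
  exact Finset.sum_congr rfl fun y _ => (integral_const_mul _ _).symm

theorem twirl_eq_self {n : ℕ} {ρ : Matrix (Basis n) (Basis n) ℂ}
    (h : ∀ U, Commute (tensorPower n U) ρ) : twirl n ρ = ρ := by
  ext x y
  have : ∀ U, tensorPower n U * ρ * (tensorPower n U)ᴴ = ρ := fun U => by
    rw [(h U).eq, mul_assoc, tensorPower_mul_conjTranspose_self, mul_one]
  simp [twirl, this]

theorem tensorPower_mul_twirl_mul_conjTranspose (n : ℕ) (ρ : Matrix (Basis n) (Basis n) ℂ)
    (V : SU2) : tensorPower n V * twirl n ρ * (tensorPower n V)ᴴ = twirl n ρ := by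
  have key : ∀ (A : Matrix (Basis n) (Basis n) ℂ) (x y : Basis n),
      (tensorPower n V * A * (tensorPower n V)ᴴ) x y =
        ∑ a, ∑ b, (Matrix.of fun a b => tensorPower n V x a * (tensorPower n V)ᴴ b y) a b * A a b := by
    intro A x y
    simp only [Matrix.mul_apply, Finset.sum_mul, Matrix.of_apply]
    rw [Finset.sum_comm]
    exact Finset.sum_congr rfl fun a _ => Finset.sum_congr rfl fun b _ => by ring
  ext x y
  rw [key, sum_mul_twirl]
  simp only [← key]
  -- Left invariance of Haar measure: the substitution `U ↦ V * U` absorbs the conjugation by `V`.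
  rw [twirl, Matrix.of_apply, ← integral_mul_left_eq_self
    (fun U => (tensorPower n U * ρ * (tensorPower n U)ᴴ) x y) V]
  simp only [tensorPower_mul, Matrix.conjTranspose_mul, mul_assoc]

theorem tensorPower_commute_twirl (n : ℕ) (ρ : Matrix (Basis n) (Basis n) ℂ) (V : SU2) :
    Commute (tensorPower n V) (twirl n ρ) := by
  have h := congrArg (· * tensorPower n V) (tensorPower_mul_twirl_mul_conjTranspose n ρ V)
  simpa only [mul_assoc, tensorPower_conjTranspose_mul_self, mul_one, commute_iff_eq] using h

theorem IsDensity.twirl {n : ℕ} {ρ : Matrix (Basis n) (Basis n) ℂ} (h : IsDensity ρ) :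
    IsDensity (twirl n ρ) := by
  have hpos : ∀ U : SU2, (tensorPower n U * ρ * (tensorPower n U)ᴴ).PosSemidef := fun U =>
    h.1.mul_mul_conjTranspose_same _
  refine ⟨.of_dotProduct_mulVec_nonneg ?_ fun v => ?_, ?_⟩
  · ext x y
    simp only [Twirl.twirl, Matrix.conjTranspose_apply, Matrix.of_apply]
    rw [RCLike.star_def, ← integral_conj]
    exact integral_congr_ae (.of_forall fun U => (hpos U).1.apply x y)
  · have key : ∀ A : Matrix (Basis n) (Basis n) ℂ, star v ⬝ᵥ (A *ᵥ v) =
        ∑ x, ∑ y, (Matrix.of fun x y => star v x * v y) x y * A x y := fun A => by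
      simp only [dotProduct, Matrix.mulVec, Finset.mul_sum, Matrix.of_apply]
      exact Finset.sum_congr rfl fun a _ => Finset.sum_congr rfl fun b _ => by ring
    rw [key, sum_mul_twirl]
    simp only [← key]
    exact integral_nonneg fun U => (hpos U).dotProduct_mulVec_nonneg v
  · have key : ∀ A : Matrix (Basis n) (Basis n) ℂ, A.trace =
        ∑ x, ∑ y, (1 : Matrix (Basis n) (Basis n) ℂ) x y * A x y := fun A => by
      simp [Matrix.trace, Matrix.one_apply]
    rw [key, sum_mul_twirl]
    simp only [← key]
    have : ∀ U : SU2, (tensorPower n U * ρ * (tensorPower n U)ᴴ).trace = 1 := fun U => by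
      rw [Matrix.trace_mul_comm, ← mul_assoc, tensorPower_conjTranspose_mul_self, one_mul, h.2]
    simp [this]

theorem mem_image_twirl_iff {n : ℕ} {ρ : Matrix (Basis n) (Basis n) ℂ} :
    ρ ∈ twirl n '' {ρ₀ | IsDensity ρ₀} ↔ IsDensity ρ ∧ ∀ U, Commute (tensorPower n U) ρ := by
  constructor
  · rintro ⟨ρ₀, h, rfl⟩
    exact ⟨h.twirl, tensorPower_commute_twirl n ρ₀⟩
  · rintro ⟨h, hc⟩
    exact ⟨ρ, h, twirl_eq_self hc⟩

end Haar

/-! ### Partial traces and rank-one operators. -/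

section PartialTrace

variable {α β : Type*} [Fintype α] [Fintype β]

theorem partialTraceB_kronecker_one_mul [DecidableEq β] (A : Matrix α α ℂ) (σ : Matrix (α × β) (α × β) ℂ) :
    partialTraceB ((A ⊗ₖ (1 : Matrix β β ℂ)) * σ) = A * partialTraceB σ := by
  ext a a'
  simp only [partialTraceB, Matrix.of_apply, Matrix.mul_apply, Matrix.kroneckerMap_apply,
    Fintype.sum_prod_type, Matrix.one_apply, mul_ite, mul_one, mul_zero, ite_mul, zero_mul,
    Finset.sum_ite_eq, Finset.mem_univ, if_true, Finset.mul_sum]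
  exact Finset.sum_comm

theorem partialTraceB_mul_kronecker_one [DecidableEq β] (A : Matrix α α ℂ) (σ : Matrix (α × β) (α × β) ℂ) :
    partialTraceB (σ * (A ⊗ₖ (1 : Matrix β β ℂ))) = partialTraceB σ * A := by
  ext a a'
  simp only [partialTraceB, Matrix.of_apply, Matrix.mul_apply, Matrix.kroneckerMap_apply,
    Fintype.sum_prod_type, Matrix.one_apply, mul_ite, mul_one, mul_zero,
    Finset.sum_ite_eq', Finset.mem_univ, if_true, Finset.sum_mul]
  exact Finset.sum_comm

theorem partialTraceB_one_kronecker_mul [DecidableEq α] (B : Matrix β β ℂ) (σ : Matrix (α × β) (α × β) ℂ) :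
    partialTraceB (((1 : Matrix α α ℂ) ⊗ₖ B) * σ) =
      partialTraceB (σ * ((1 : Matrix α α ℂ) ⊗ₖ B)) := by
  ext a a'
  simp only [partialTraceB, Matrix.of_apply, Matrix.mul_apply, Matrix.kroneckerMap_apply,
    Fintype.sum_prod_type_right, Matrix.one_apply, ite_mul, one_mul, zero_mul, mul_ite, mul_zero,
    Finset.sum_ite_eq, Finset.sum_ite_eq', Finset.mem_univ, if_true]
  rw [Finset.sum_comm]
  simp only [mul_comm]

theorem IsDensity.partialTraceB {σ : Matrix (α × β) (α × β) ℂ} (h : IsDensity σ) :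
    IsDensity (partialTraceB σ) := by
  refine ⟨?_, ?_⟩
  · have : Twirl.partialTraceB σ = ∑ b, σ.submatrix (fun a => (a, b)) (fun a => (a, b)) := by
      ext a a'
      simp [Twirl.partialTraceB, Matrix.sum_apply]
    rw [this]
    exact Matrix.posSemidef_sum _ fun b _ => h.1.submatrix _
  · rw [← h.2]
    simp [Matrix.trace, Twirl.partialTraceB, Fintype.sum_prod_type]

theorem partialTraceB_ketbra {α β : Type*} [Fintype β] (M : Matrix α β ℂ) :
    partialTraceB (ketbra fun p : α × β => M p.1 p.2) = M * Mᴴ := by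
  ext a a'
  simp [partialTraceB, ketbra, Matrix.vecMulVec_apply, Matrix.mul_apply]

theorem trace_ketbra (ψ : α → ℂ) : (ketbra ψ).trace = star ψ ⬝ᵥ ψ := by
  rw [ketbra, Matrix.trace_vecMulVec, dotProduct_comm]

theorem trace_partialTraceB (σ : Matrix (α × β) (α × β) ℂ) :
    (partialTraceB σ).trace = σ.trace := by
  simp [Matrix.trace, partialTraceB, Fintype.sum_prod_type]

theorem IsUnitVector.isDensity_ketbra {ψ : α → ℂ} (h : IsUnitVector ψ) : IsDensity (ketbra ψ) :=
  ⟨Matrix.posSemidef_vecMulVec_self_star ψ, (trace_ketbra ψ).trans h⟩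

theorem ketbra_mulVec (ψ v : α → ℂ) : ketbra ψ *ᵥ v = (star ψ ⬝ᵥ v) • ψ := by
  rw [ketbra, Matrix.vecMulVec_mulVec]
  ext; simp [mul_comm]

end PartialTrace

/-! ### Entanglement of pure states. -/

section Entanglement

variable {α β : Type*} [Fintype α] [Fintype β]

theorem dotProduct_ketbra_mulVec (ψ v : α → ℂ) :
    star v ⬝ᵥ (ketbra ψ *ᵥ v) = ((‖star ψ ⬝ᵥ v‖ ^ 2 : ℝ) : ℂ) := by
  have : star v ⬝ᵥ ψ = star (star ψ ⬝ᵥ v) := by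
    rw [← Matrix.star_dotProduct_star, star_star, dotProduct_comm]
  rw [ketbra_mulVec, dotProduct_smul, this, smul_eq_mul, RCLike.star_def, RCLike.mul_conj]
  norm_cast

/-- A pure state is an extreme point: it has only trivial decompositions into pure states. -/
theorem ketbra_eq_of_mixture {m : ℕ} {w : Fin m → ℝ} {Ψ : Fin m → α → ℂ} {ψ : α → ℂ}
    (hw : ∀ i, 0 < w i) (hΨ : ∀ i, IsUnitVector (Ψ i)) (hψ : IsUnitVector ψ)
    (h : ketbra ψ = ∑ i, (w i : ℂ) • ketbra (Ψ i)) (i : Fin m) : ketbra (Ψ i) = ketbra ψ := by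
  -- The quadratic form of the mixture at `v` is a sum of nonnegative terms, so if it vanishes each
  -- term does.
  have horth : ∀ v, star ψ ⬝ᵥ v = 0 → star (Ψ i) ⬝ᵥ v = 0 := by
    intro v hv
    have h1 : star v ⬝ᵥ (ketbra ψ *ᵥ v) = 0 := by simp [dotProduct_ketbra_mulVec, hv]
    rw [h, Matrix.sum_mulVec, dotProduct_sum] at h1
    simp only [Matrix.smul_mulVec, dotProduct_smul, dotProduct_ketbra_mulVec, smul_eq_mul] at h1
    have h2 : ∑ j, w j * ‖star (Ψ j) ⬝ᵥ v‖ ^ 2 = 0 := by exact_mod_cast h1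
    have h3 := (Finset.sum_eq_zero_iff_of_nonneg fun j _ =>
      mul_nonneg (hw j).le (sq_nonneg _)).mp h2 i (Finset.mem_univ i)
    simpa [(hw i).ne'] using h3
  -- The component of `Ψ i` orthogonal to `ψ` is orthogonal to `Ψ i` too, hence zero; `c` is then a
  -- phase, which the projector forgets.
  set c := star ψ ⬝ᵥ Ψ i with hc
  have hψ' : star ψ ⬝ᵥ ψ = 1 := hψ
  have hv : star ψ ⬝ᵥ (Ψ i - c • ψ) = 0 := by
    rw [dotProduct_sub, dotProduct_smul, hψ', ← hc]; simp
  have hv' := horth _ hv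
  have hzero : star (Ψ i - c • ψ) ⬝ᵥ (Ψ i - c • ψ) = 0 := by
    rw [star_sub, sub_dotProduct, hv', star_smul, smul_dotProduct, hv]; simp
  have heq : Ψ i = c • ψ := sub_eq_zero.mp (dotProduct_star_self_eq_zero.mp
    (hzero))
  have hcc : star c * c = 1 := by
    have h1 : star (Ψ i) ⬝ᵥ Ψ i = 1 := hΨ i
    rw [heq, star_smul, smul_dotProduct, dotProduct_smul, hψ'] at h1
    simpa using h1
  rw [heq]
  ext a b
  simp only [ketbra, Matrix.vecMulVec_apply, Pi.smul_apply, Pi.star_apply, smul_eq_mul, star_mul]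
  linear_combination (ψ a * star (ψ b)) * hcc

theorem averageEntanglements_ketbra [DecidableEq α] {ψ : α × β → ℂ} (hψ : IsUnitVector ψ) :
    averageEntanglements (ketbra ψ) = {entropy (partialTraceB (ketbra ψ))} := by
  ext e
  constructor
  · rintro ⟨m, w, Ψ, hw, hsum, hΨ, hdec, rfl⟩
    simp only [ketbra_eq_of_mixture hw hΨ hψ hdec, ← Finset.sum_mul, hsum, one_mul]
    rfl
  · rintro rfl
    exact ⟨1, fun _ => 1, fun _ => ψ, by simp, by simp, fun _ => hψ, by simp, by simp⟩

theorem IsPure.entropy_partialTraceB [DecidableEq α] {σ : Matrix (α × β) (α × β) ℂ} (hσ : IsPure σ) :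
    entropy (partialTraceB σ) = entanglement σ := by
  obtain ⟨ψ, hψ, rfl⟩ := hσ
  rw [entanglement, averageEntanglements_ketbra hψ, csInf_singleton]

end Entanglement

/-! ### Invariant states and purifications. -/

section Invariant

theorem kronecker_mulVec_uncurry {α β : Type*} [Fintype α] [Fintype β] (A : Matrix α α ℂ)
    (B : Matrix β β ℂ) (M : Matrix α β ℂ) :
    (A ⊗ₖ B) *ᵥ (fun p : α × β => M p.1 p.2) = fun p => (A * M * Bᵀ) p.1 p.2 := by
  ext ⟨a, b⟩
  simp only [Matrix.mulVec, dotProduct, Matrix.kroneckerMap_apply, Fintype.sum_prod_type_right,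
    Matrix.mul_apply, Matrix.transpose_apply, Finset.sum_mul]
  exact Finset.sum_congr rfl fun _ _ => Finset.sum_congr rfl fun _ _ => by ring

theorem mul_spinFlip_mem_invariantSubspace {n : ℕ} {N : Matrix (Basis n) (Basis n) ℂ}
    (h : ∀ U, Commute (tensorPower n U) N) :
    (fun p : Basis n × Basis n => (N * spinFlip n) p.1 p.2) ∈ invariantSubspace n := by
  intro U
  rw [kronecker_mulVec_uncurry, ← mul_assoc, (h U).eq, mul_assoc, mul_assoc, ← mul_assoc _ _ _ᵀ,
    tensorPower_mul_spinFlip_mul_transpose]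

theorem IsDensityOn.commute_partialTraceB {n : ℕ}
    {σ : Matrix (Basis n × Basis n) (Basis n × Basis n) ℂ}
    (h : IsDensityOn (invariantSubspace n) σ) (U : SU2) :
    Commute (tensorPower n U) (partialTraceB σ) := by
  set T := tensorPower n U with hT
  have hTT : Tᴴ * T = 1 := tensorPower_conjTranspose_mul_self n U
  have hTT' : T * Tᴴ = 1 := tensorPower_mul_conjTranspose_self n U
  have hσ : σᴴ = σ := h.1.1.1
  -- Each column of `σ` is an image vector, hence invariant.
  have hleft : (T ⊗ₖ T) * σ = σ := by
    refine Matrix.ext_of_mulVec_single fun p => ?_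
    rw [← Matrix.mulVec_mulVec]
    exact h.2 _ U
  have hright : σ * (Tᴴ ⊗ₖ Tᴴ) = σ := by
    have := congrArg Matrix.conjTranspose hleft
    rwa [Matrix.conjTranspose_mul, Matrix.conjTranspose_kronecker, hσ] at this
  have hl : (T ⊗ₖ (1 : Matrix (Basis n) (Basis n) ℂ)) * σ = (1 ⊗ₖ Tᴴ) * σ := by
    conv_rhs => rw [← hleft]
    rw [← mul_assoc, ← Matrix.mul_kronecker_mul, hTT, one_mul]
  have hr : σ * (1 ⊗ₖ Tᴴ) = σ * (T ⊗ₖ (1 : Matrix (Basis n) (Basis n) ℂ)) := by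
    conv_rhs => rw [← hright]
    rw [mul_assoc, ← Matrix.mul_kronecker_mul, hTT, mul_one]
  rw [commute_iff_eq, ← partialTraceB_kronecker_one_mul, hl, partialTraceB_one_kronecker_mul, hr,
    partialTraceB_mul_kronecker_one]

/-- The canonical purification `√ρ ⊗ 1` applied to the singlet-type vector is invariant. -/
theorem exists_invariant_purification {n : ℕ} {ρ : Matrix (Basis n) (Basis n) ℂ}
    (hρ : IsDensity ρ) (hc : ∀ U, Commute (tensorPower n U) ρ) :
    ∃ σ, IsDensityOn (invariantSubspace n) σ ∧ IsPure σ ∧ partialTraceB σ = ρ := by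
  have hnn : 0 ≤ ρ := hρ.1.nonneg
  -- Functional calculus of `ρ` preserves its commutant.
  have hN : ∀ U, Commute (tensorPower n U) (CFC.sqrt ρ) := fun U => by
    rw [CFC.sqrt_eq_cfc]
    exact ((hc U).symm.cfc_nnreal _).symm
  have hH : (CFC.sqrt ρ)ᴴ = CFC.sqrt ρ := (Matrix.nonneg_iff_posSemidef.mp (CFC.sqrt_nonneg ρ)).1
  set ψ : Basis n × Basis n → ℂ := fun p => (CFC.sqrt ρ * spinFlip n) p.1 p.2 with hψ
  have hmem : ψ ∈ invariantSubspace n := mul_spinFlip_mem_invariantSubspace hN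
  have htr : partialTraceB (ketbra ψ) = ρ := by
    rw [hψ, partialTraceB_ketbra, Matrix.conjTranspose_mul, mul_assoc, ← mul_assoc (spinFlip n),
      spinFlip_mul_conjTranspose, one_mul, hH, CFC.sqrt_mul_sqrt_self ρ]
  have hunit : IsUnitVector ψ := by
    rw [IsUnitVector, ← trace_ketbra, ← trace_partialTraceB, htr, hρ.2]
  refine ⟨ketbra ψ, ⟨hunit.isDensity_ketbra, fun v => ?_⟩, ⟨ψ, hunit, rfl⟩, htr⟩
  rw [ketbra_mulVec]
  exact Submodule.smul_mem _ _ hmem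

end Invariant

end Twirl

theorem proposition4 (n : ℕ) :
    Twirl.partialTraceB '' {σ | Twirl.IsDensityOn (Twirl.invariantSubspace n) σ} =
      Twirl.twirl n '' {ρ | Twirl.IsDensity ρ} ∧
    ∀ ρ ∈ Twirl.twirl n '' {ρ₀ | Twirl.IsDensity ρ₀},
      (∃ σ, Twirl.IsDensityOn (Twirl.invariantSubspace n) σ ∧ Twirl.IsPure σ ∧
        Twirl.partialTraceB σ = ρ ∧ Twirl.entropy ρ = Twirl.entanglement σ) ∧
      ∀ σ, Twirl.IsDensityOn (Twirl.invariantSubspace n) σ → Twirl.IsPure σ →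
        Twirl.partialTraceB σ = ρ → Twirl.entropy ρ = Twirl.entanglement σ := by
  refine ⟨Set.Subset.antisymm ?_ ?_, ?_⟩
  · rintro _ ⟨σ, hσ, rfl⟩
    exact Twirl.mem_image_twirl_iff.mpr ⟨hσ.1.partialTraceB, hσ.commute_partialTraceB⟩
  · intro ρ hρ
    obtain ⟨hd, hc⟩ := Twirl.mem_image_twirl_iff.mp hρ
    obtain ⟨σ, hσ, -, htr⟩ := Twirl.exists_invariant_purification hd hc
    exact ⟨σ, hσ, htr⟩
  · intro ρ hρ
    obtain ⟨hd, hc⟩ := Twirl.mem_image_twirl_iff.mp hρ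
    obtain ⟨σ, hσ, hp, htr⟩ := Twirl.exists_invariant_purification hd hc
    exact ⟨⟨σ, hσ, hp, htr, htr ▸ hp.entropy_partialTraceB⟩,
      fun τ _ hτ h => h ▸ hτ.entropy_partialTraceB⟩
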